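/- Extreme Value Theorem. A real $\Phi$-algebra is a real vector lattice $E$ with an associative bilinear multiplication and a multiplicative unit $e$ such that $xy\ge 0$ whenever $x,y\ge 0$, and such that $x\wedge y=0$ and $z\ge 0$ imply $(xz)\wedge y=(zx)\wedge y=0$. It is Dedekind complete if every nonempty subset that is bounded above has a supremum. A net $(x_\alpha)$ in $E$ converges in order to $x\in E$ if there is a set $S\subseteq E$ with $\inf S=0$ such that for every $\varepsilon\in S$ there is an $\alpha_0$ with $|x_\alpha-x|\le\varepsilon$ for all $\alpha\ge\alpha_0$. Let $D\subseteq E$. A function $f\colon D\to E$ is order continuous if for every $c\in D$ and every net $(x_\alpha)$ in $D$ converging in order to $c$, the net $(f(x_\alpha))$ converges in order to $f(c)$. It is locally band preserving if for all $x,y\in D$ and $z\in E$, $|x-y|\wedge|z|=0$ implies $|f(x)-f(y)|\wedge|z|=0$. Let $E$ be a Dedekind complete real $\Phi$-algebra, let $a,b\in E$ with $a\le b$, let $[a,b]=\{x\in E: a\le x\le b\}$, and let $f\colon[a,b]\to E$ be order continuous and locally band preserving. Then there exist $c,d\in[a,b]$ such that $f(c)\le f(x)\le f(d)$ for all $x\in[a,b]$.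 -/

import Mathlib

universe u v

/-- A real `Φ`-algebra: a real vector lattice `E` which is an associative unital real algebra such
that products of positive elements are positive and such that `x ⊓ y = 0` implies
`(x * z) ⊓ y = (z * x) ⊓ y = 0` for every `z ≥ 0` (a unital `f`-algebra). -/
class IsPhiAlgebra (E : Type u) [Ring E] [Lattice E] [Algebra ℝ E] : Prop
    extends IsOrderedAddMonoid E, IsOrderedModule ℝ E where
  mul_nonneg' : ∀ x y : E, 0 ≤ x → 0 ≤ y → 0 ≤ x * y
  mul_right_inf : ∀ x y z : E, x ⊓ y = 0 → 0 ≤ z → (x * z) ⊓ y = 0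
  mul_left_inf : ∀ x y z : E, x ⊓ y = 0 → 0 ≤ z → (z * x) ⊓ y = 0

/-- The net `x` converges in order to `l`: there is a set `S` with infimum `0` such that
for each `ε ∈ S` we eventually have `|x i - l| ≤ ε`. -/
def OrderConverges {E : Type u} [Lattice E] [AddCommGroup E] {ι : Type v} [Preorder ι]
    (x : ι → E) (l : E) : Prop :=
  ∃ S : Set E, IsGLB S 0 ∧ ∀ ε ∈ S, ∃ i₀ : ι, ∀ i, i₀ ≤ i → |x i - l| ≤ ε

/-- `f : D → E` is order continuous at `c ∈ D`: it maps every net in `D` converging in order to `c`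
to a net converging in order to `f c`. Nets are indexed by nonempty directed preordered sets; index
sets of the same size as `E` are all that is needed, as convergence of such nets already gives the
`ε`-`δ` form of order continuity. -/
def OrderContinuousAt {E : Type u} [Lattice E] [AddCommGroup E] {D : Set E}
    (f : D → E) (c : D) : Prop :=
  ∀ (ι : Type u) [Preorder ι] [IsDirectedOrder ι] [Nonempty ι] (x : ι → D),
    OrderConverges (fun i => (x i : E)) (c : E) → OrderConverges (fun i => f (x i)) (f c)

/-- `f : D → E` is order continuous at each point of its domain. -/
def OrderContinuous {E : Type u} [Lattice E] [AddCommGroup E] {D : Set E} (f : D → E) : Prop :=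
  ∀ c : D, OrderContinuousAt f c

/-- `f : D → E` is locally band preserving. -/
def LocallyBandPreserving {E : Type u} [Lattice E] [AddCommGroup E] {D : Set E}
    (f : D → E) : Prop :=
  ∀ (x y : D) (z : E), |(x : E) - (y : E)| ⊓ |z| = 0 → |f x - f y| ⊓ |z| = 0

section VectorLattice

variable {E : Type u} [AddCommGroup E]

section Disjointness

variable [Lattice E]

/-! Completeness is used only in the domain, so `f` need not be known to be bounded. Mixing two
points along a band shows that the range of `f` is directed upwards (`exists_le_le`). Superlevel
sets are closed under `⊔` (`inf_le_apply`), hence by order continuity each has a greatest element `m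
x`. As `f x` grows, `m x` decreases, so these points form a downward directed family; continuity at
its infimum gives the maximum. The minimum comes from `-f`. -/

theorem inf_eq_zero_of_le {x y t : E} (hx : 0 ≤ x) (hxy : x ≤ y) (ht : 0 ≤ t) (h : y ⊓ t = 0) :
    x ⊓ t = 0 :=
  le_antisymm (h ▸ inf_le_inf_right t hxy) (le_inf hx ht)

theorem LocallyBandPreserving.neg {D : Set E} {f : D → E} (hf : LocallyBandPreserving f) :
    LocallyBandPreserving fun x => -f x := by
  intro x y z h
  rw [neg_sub_neg, abs_sub_comm]
  exact hf x y z h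

theorem OrderContinuous.neg {D : Set E} {f : D → E} (hf : OrderContinuous f) :
    OrderContinuous fun x => -f x := by
  intro c ι _ _ _ x hx
  obtain ⟨S, hS, h⟩ := hf c ι x hx
  refine ⟨S, hS, fun ε hε => ?_⟩
  obtain ⟨i₀, hi₀⟩ := h ε hε
  refine ⟨i₀, fun i hi => ?_⟩
  rw [neg_sub_neg, abs_sub_comm]
  exact hi₀ i hi

variable [IsOrderedAddMonoid E]

theorem add_inf_eq_zero {x y t : E} (hx : 0 ≤ x) (hy : 0 ≤ y) (hxt : x ⊓ t = 0)
    (hyt : y ⊓ t = 0) : (x + y) ⊓ t = 0 := by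
  have ht : 0 ≤ t := hxt ▸ inf_le_right
  refine le_antisymm ?_ (le_inf (add_nonneg hx hy) ht)
  have h₁ : (x + y) ⊓ t ≤ x + y ⊓ t := by
    rw [add_inf]
    exact le_inf inf_le_left (inf_le_right.trans (le_add_of_nonneg_left hx))
  rw [hyt, add_zero] at h₁
  exact (le_inf h₁ inf_le_right).trans hxt.le

/-- `x⁺` lies below `p + q` and is disjoint from it, so it vanishes. -/
theorem nonpos_of_le_add_of_disjoint {x p q : E} (hp : 0 ≤ p) (hq : 0 ≤ q) (h : x ≤ p + q)
    (hxp : p ⊓ x⁺ = 0) (hxq : q ⊓ x⁺ = 0) : x ≤ 0 := by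
  have h₁ : x⁺ ≤ p + q := sup_le h (add_nonneg hp hq)
  have h₂ := add_inf_eq_zero hp hq hxp hxq
  rw [inf_eq_right.2 h₁] at h₂
  exact (le_posPart x).trans h₂.le

theorem posPart_le_abs_self (x : E) : x⁺ ≤ |x| := sup_le (le_abs_self x) (abs_nonneg x)

theorem posPart_inf_posPart_sub (x y : E) : (x - y)⁺ ⊓ (y - x)⁺ = 0 := by
  rw [← neg_sub x y, posPart_neg]
  exact posPart_inf_negPart_eq_zero _

/-- A locally band preserving function satisfies `f x ⊓ f y ≤ f (x ⊔ y)`. -/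
theorem LocallyBandPreserving.inf_le_apply {D : Set E} {f : D → E} (hf : LocallyBandPreserving f)
    {x y u : D} (hu : (u : E) = (x : E) ⊔ (y : E)) : f x ⊓ f y ≤ f u := by
  have hux : |(u : E) - x| = ((y : E) - x)⁺ := by
    rw [hu, sup_sub, sub_self, posPart_def, sup_comm, abs_of_nonneg le_sup_right]
  have huy : |(u : E) - y| = ((x : E) - y)⁺ := by
    rw [hu, sup_sub, sub_self, posPart_def, abs_of_nonneg le_sup_right]
  -- `|u - x|` and `|u - y|` are disjoint. Using `hf` once on each side makes `|f u - f x|` and `|f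
  -- u - f y|` disjoint, and `f x ⊓ f y - f u` lies below both.
  have h₁ : |f u - f x| ⊓ |((x : E) - y)⁺| = 0 := by
    apply hf
    rw [hux, abs_of_nonneg (posPart_nonneg _), posPart_inf_posPart_sub]
  have h₂ : |f u - f y| ⊓ |(|f u - f x|)| = 0 := by
    apply hf
    rwa [huy, abs_abs, inf_comm, ← abs_of_nonneg (posPart_nonneg ((x : E) - y))]
  rw [abs_abs] at h₂
  rw [← sub_nonpos, ← h₂, abs_sub_comm, abs_sub_comm (f u)]
  exact le_inf ((sub_le_sub_right inf_le_right _).trans (le_abs_self _))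
    ((sub_le_sub_right inf_le_left _).trans (le_abs_self _))

/-! ### Order limits along directed sets -/

theorem OrderConverges.le_of_frequently {ι : Type v} [Preorder ι] {x : ι → E} {l c : E}
    (hx : OrderConverges x l) (hc : ∀ i, ∃ j, i ≤ j ∧ c ≤ x j) : c ≤ l := by
  obtain ⟨S, hS, h⟩ := hx
  rw [← sub_nonpos]
  refine hS.2 fun ε hε => ?_
  obtain ⟨i, hi⟩ := h ε hε
  obtain ⟨j, hij, hj⟩ := hc i
  exact (sub_le_sub_right hj l).trans ((le_abs_self _).trans (hi j hij))

theorem Monotone.orderConverges {ι : Type v} [Preorder ι] {x : ι → E} {l : E}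
    (hx : Monotone x) (hl : IsLUB (Set.range x) l) : OrderConverges x l := by
  refine ⟨Set.range fun i => l - x i, ⟨?_, fun t ht => ?_⟩, ?_⟩
  · rintro _ ⟨i, rfl⟩
    exact sub_nonneg.2 (hl.1 ⟨i, rfl⟩)
  · have : l ≤ l - t := hl.2 (by
      rintro _ ⟨i, rfl⟩
      exact le_sub_comm.1 (ht ⟨i, rfl⟩))
    simpa using this
  · rintro _ ⟨i, rfl⟩
    refine ⟨i, fun j hij => ?_⟩
    rw [abs_sub_comm, abs_of_nonneg (sub_nonneg.2 (hl.1 ⟨j, rfl⟩))]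
    exact sub_le_sub_left (hx hij) l

theorem Antitone.orderConverges {ι : Type v} [Preorder ι] {x : ι → E} {l : E}
    (hx : Antitone x) (hl : IsGLB (Set.range x) l) : OrderConverges x l := by
  refine ⟨Set.range fun i => x i - l, ⟨?_, fun t ht => ?_⟩, ?_⟩
  · rintro _ ⟨i, rfl⟩
    exact sub_nonneg.2 (hl.1 ⟨i, rfl⟩)
  · have : t + l ≤ l := hl.2 (by
      rintro _ ⟨i, rfl⟩
      exact le_sub_iff_add_le.1 (ht ⟨i, rfl⟩))
    simpa using this
  · rintro _ ⟨i, rfl⟩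
    refine ⟨i, fun j hij => ?_⟩
    rw [abs_of_nonneg (sub_nonneg.2 (hl.1 ⟨j, rfl⟩))]
    exact sub_le_sub_right (hx hij) l

theorem OrderContinuous.le_apply_of_isLUB {D : Set E} {f : D → E} (hf : OrderContinuous f)
    {A : Set D} (hA : A.Nonempty) (hdir : DirectedOn (· ≤ ·) A) {d : D}
    (hd : IsLUB (Subtype.val '' A) (d : E)) {c : E} (hc : ∀ x ∈ A, c ≤ f x) : c ≤ f d := by
  have : Nonempty A := hA.to_subtype
  have : IsDirectedOrder A := ⟨fun x y => by
    obtain ⟨z, hz, hxz, hyz⟩ := hdir x x.2 y y.2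
    exact ⟨⟨z, hz⟩, hxz, hyz⟩⟩
  have hconv : OrderConverges (fun i : A => ((i : D) : E)) (d : E) := by
    refine Monotone.orderConverges (fun _ _ h => h) ?_
    rwa [Set.image_eq_range] at hd
  exact (hf d A (fun i => i) hconv).le_of_frequently fun i => ⟨i, le_rfl, hc i i.2⟩

/-- The bound is required only cofinally: in the application `f (m y)` dominates a given value only
for suitable `y`. -/
theorem OrderContinuous.le_apply_of_isGLB {D : Set E} {f : D → E} (hf : OrderContinuous f)
    {A : Set D} (hA : A.Nonempty) (hdir : DirectedOn (· ≥ ·) A) {d : D}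
    (hd : IsGLB (Subtype.val '' A) (d : E)) {c : E}
    (hc : ∀ x ∈ A, ∃ y ∈ A, y ≤ x ∧ c ≤ f y) : c ≤ f d := by
  have : Nonempty (OrderDual A) := hA.to_subtype
  have : IsDirectedOrder (OrderDual A) := ⟨fun x y => by
    obtain ⟨z, hz, hxz, hyz⟩ := hdir x.ofDual x.ofDual.2 y.ofDual y.ofDual.2
    exact ⟨OrderDual.toDual ⟨z, hz⟩, hxz, hyz⟩⟩
  have hconv : OrderConverges (fun i : OrderDual A => ((i.ofDual : D) : E)) (d : E) := by
    refine Antitone.orderConverges (fun _ _ h => h) ?_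
    rwa [Set.image_eq_range] at hd
  refine (hf d (OrderDual A) (fun i => i.ofDual) hconv).le_of_frequently fun i => ?_
  obtain ⟨y, hy, hyi, hcy⟩ := hc i.ofDual i.ofDual.2
  exact ⟨OrderDual.toDual ⟨y, hy⟩, hyi, hcy⟩

end Disjointness

/-! ### Band projections and mixing -/

variable [ConditionallyCompleteLattice E] [IsOrderedAddMonoid E]

/-- The band projection of `g ≥ 0` onto the band generated by `v ≥ 0`. -/
theorem exists_bandProjection {g v : E} (hg : 0 ≤ g) (hv : 0 ≤ v) :
    ∃ G, 0 ≤ G ∧ G ≤ g ∧ (g - G) ⊓ v = 0 ∧ ∀ t, 0 ≤ t → v ⊓ t = 0 → G ⊓ t = 0 := by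
  set S : Set E := {s | 0 ≤ s ∧ s ≤ g ∧ ∀ t, 0 ≤ t → v ⊓ t = 0 → s ⊓ t = 0} with hS
  have h0 : (0 : E) ∈ S := ⟨le_rfl, hg, fun t ht _ => inf_eq_left.2 ht⟩
  have hlub : IsLUB S (sSup S) := isLUB_csSup ⟨0, h0⟩ ⟨g, fun s hs => hs.2.1⟩
  set G := sSup S
  have hG0 : 0 ≤ G := hlub.1 h0
  have hGg : G ≤ g := hlub.2 fun s hs => hs.2.1
  have hGt : ∀ t, 0 ≤ t → v ⊓ t = 0 → G ⊓ t = 0 := by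
    intro t ht hvt
    refine le_antisymm ?_ (le_inf hG0 ht)
    -- `s ↦ s - s ⊓ t = (s - t)⁺` is monotone and fixes each `s ∈ S`.
    have : G ≤ G - G ⊓ t := hlub.2 fun s hs => by
      have h := hs.2.2 t ht hvt
      have h₁ : s - s ⊓ t ≤ G - G ⊓ t := by
        rw [sub_inf, sub_inf, sub_self, sub_self]
        exact sup_le_sup_left (sub_le_sub_right (hlub.1 hs) t) 0
      rwa [h, sub_zero] at h₁
    simpa using this
  refine ⟨G, hG0, hGg, ?_, hGt⟩
  have hr : 0 ≤ (g - G) ⊓ v := le_inf (sub_nonneg.2 hGg) hv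
  -- By maximality of `G`, the added piece must be zero.
  have hmem : G + (g - G) ⊓ v ∈ S := by
    refine ⟨add_nonneg hG0 hr, ?_, fun t ht hvt => add_inf_eq_zero hG0 hr (hGt t ht hvt)
      (inf_eq_zero_of_le hr inf_le_right ht hvt)⟩
    exact (add_le_add_right inf_le_left G).trans (add_sub_cancel G g).le
  have := hlub.1 hmem
  exact le_antisymm (by simpa using this) hr

/-- The element which agrees with `x` on the band generated by `v ≥ 0` and with `y` on its
disjoint complement. -/
theorem exists_mix (x y : E) {v : E} (hv : 0 ≤ v) :
    ∃ z, x ⊓ y ≤ z ∧ z ≤ x ⊔ y ∧ |z - x| ⊓ v = 0 ∧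
      ∀ t, 0 ≤ t → v ⊓ t = 0 → |z - y| ⊓ t = 0 := by
  obtain ⟨G, hG0, hGg, hGv, hGt⟩ := exists_bandProjection (posPart_nonneg (x - y)) hv
  obtain ⟨H, hH0, hHh, hHv, hHt⟩ := exists_bandProjection (negPart_nonneg (x - y)) hv
  have hxy : x = y + (x - y)⁺ - (x - y)⁻ := by
    rw [add_sub_assoc, posPart_sub_negPart, add_sub_cancel]
  have hsup : y + (x - y)⁺ = x ⊔ y := by
    rw [posPart_def, add_sup, add_sub_cancel, add_zero]
  have hinf : y - (x - y)⁻ = x ⊓ y := by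
    rw [negPart_def, sub_sup, sub_zero, sub_neg_eq_add, add_sub_cancel]
  refine ⟨y + G - H, ?_, ?_, ?_, fun t ht hvt => ?_⟩
  · rw [← hinf]
    exact sub_le_sub (le_add_of_nonneg_right hG0) hHh
  · rw [← hsup]
    exact (sub_le_self _ hH0).trans (add_le_add_right hGg y)
  · refine inf_eq_zero_of_le (abs_nonneg _) ?_ hv
      (add_inf_eq_zero (sub_nonneg.2 hGg) (sub_nonneg.2 hHh) hGv hHv)
    have : y + G - H - x = ((x - y)⁻ - H) - ((x - y)⁺ - G) := by
      nth_rw 1 [hxy]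
      abel
    rw [this, add_comm]
    refine abs_le'.2 ⟨?_, ?_⟩
    · exact (sub_le_self _ (sub_nonneg.2 hGg)).trans (le_add_of_nonneg_right (sub_nonneg.2 hGg))
    · rw [neg_sub]
      exact (sub_le_self _ (sub_nonneg.2 hHh)).trans (le_add_of_nonneg_left (sub_nonneg.2 hHh))
  · refine inf_eq_zero_of_le (abs_nonneg _) ?_ ht
      (add_inf_eq_zero hG0 hH0 (hGt t ht hvt) (hHt t ht hvt))
    have : y + G - H - y = G - H := by abel
    rw [this]
    refine abs_le'.2 ⟨?_, ?_⟩
    · exact (sub_le_self _ hH0).trans (le_add_of_nonneg_right hH0)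
    · rw [neg_sub]
      exact (sub_le_self _ hG0).trans (le_add_of_nonneg_left hG0)

/-! ### Extrema on an order interval -/

variable {a b : E} {f : Set.Icc a b → E}

/-- The range of a locally band preserving function on an order interval is directed upwards. -/
theorem LocallyBandPreserving.exists_le_le (hf : LocallyBandPreserving f) (x y : Set.Icc a b) :
    ∃ z, f x ≤ f z ∧ f y ≤ f z := by
  -- Take `x` on the band where `f x` exceeds `f y`, and `y` elsewhere.
  obtain ⟨z, hz₁, hz₂, hzx, hzy⟩ := exists_mix (x : E) (y : E) (posPart_nonneg (f x - f y))
  lift z to Set.Icc a b using ⟨(le_inf x.2.1 y.2.1).trans hz₁, hz₂.trans (sup_le x.2.2 y.2.2)⟩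
  have hA : |f z - f x| ⊓ (f x - f y)⁺ = 0 := by
    have := hf z x (f x - f y)⁺
    rw [abs_of_nonneg (posPart_nonneg (f x - f y))] at this
    exact this hzx
  have hB : ∀ t, 0 ≤ t → (f x - f y)⁺ ⊓ t = 0 → |f z - f y| ⊓ t = 0 := by
    intro t ht hvt
    have := hf z y t
    rw [abs_of_nonneg ht] at this
    exact this (hzy t ht hvt)
  have hBA := hB _ (abs_nonneg (f z - f x)) ((inf_comm _ _).trans hA)
  have hBv := hB _ (posPart_nonneg (f y - f x)) (posPart_inf_posPart_sub _ _)
  have key : ∀ w, (f w - f z)⁺ ≤ |f z - f w| := fun w => by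
    rw [abs_sub_comm]
    exact posPart_le_abs_self _
  refine ⟨z, sub_nonpos.1 ?_, sub_nonpos.1 ?_⟩
  · refine nonpos_of_le_add_of_disjoint (posPart_nonneg (f x - f y)) (abs_nonneg (f z - f y)) ?_ ?_ ?_
    · have : f x - f z = (f x - f y) + (f y - f z) := by abel
      rw [this, abs_sub_comm]
      exact add_le_add (le_posPart _) (le_abs_self _)
    · rw [inf_comm]
      exact inf_eq_zero_of_le (posPart_nonneg _) (key x) (posPart_nonneg _) hA
    · rw [inf_comm]
      exact inf_eq_zero_of_le (posPart_nonneg _) (key x) (abs_nonneg _) ((inf_comm _ _).trans hBA)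
  · refine nonpos_of_le_add_of_disjoint (posPart_nonneg (f y - f x)) (abs_nonneg (f z - f x)) ?_ ?_ ?_
    · have : f y - f z = (f y - f x) + (f x - f z) := by abel
      rw [this, abs_sub_comm]
      exact add_le_add (le_posPart _) (le_abs_self _)
    · rw [inf_comm]
      exact inf_eq_zero_of_le (posPart_nonneg _) (key y) (posPart_nonneg _) hBv
    · rw [inf_comm]
      exact inf_eq_zero_of_le (posPart_nonneg _) (key y) (abs_nonneg _) hBA

/-- A nonempty superlevel set of `f` has a greatest element. -/
theorem LocallyBandPreserving.exists_isGreatest (hlbp : LocallyBandPreserving f)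
    (hf : OrderContinuous f) (x₀ : Set.Icc a b) :
    ∃ m, IsGreatest {x | f x₀ ≤ f x} m := by
  set A : Set (Set.Icc a b) := {x | f x₀ ≤ f x}
  have hA : A.Nonempty := ⟨x₀, le_refl (f x₀)⟩
  have hlub : IsLUB (Subtype.val '' A) (sSup (Subtype.val '' A)) := by
    refine isLUB_csSup (hA.image _) ⟨b, ?_⟩
    rintro _ ⟨x, -, rfl⟩
    exact x.2.2
  have hmem : sSup (Subtype.val '' A) ∈ Set.Icc a b := by
    refine ⟨x₀.2.1.trans (hlub.1 ⟨x₀, le_refl (f x₀), rfl⟩), hlub.2 ?_⟩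
    rintro _ ⟨x, -, rfl⟩
    exact x.2.2
  refine ⟨⟨_, hmem⟩, hf.le_apply_of_isLUB hA ?_ hlub fun x hx => hx, fun x hx => hlub.1 ⟨x, hx, rfl⟩⟩
  intro x hx y hy
  let u : Set.Icc a b := ⟨(x : E) ⊔ y, x.2.1.trans le_sup_left, sup_le x.2.2 y.2.2⟩
  exact ⟨u, (le_inf hx hy).trans (hlbp.inf_le_apply (u := u) rfl),
    le_sup_left (a := (x : E)), le_sup_right (a := (x : E))⟩

theorem LocallyBandPreserving.exists_forall_le (hlbp : LocallyBandPreserving f)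
    (hf : OrderContinuous f) (hab : a ≤ b) : ∃ d, ∀ x, f x ≤ f d := by
  choose m hm using hlbp.exists_isGreatest hf
  have hanti : ∀ x y, f x ≤ f y → m y ≤ m x := fun x y h => (hm x).2 (h.trans (hm y).1)
  -- The last clause makes the values of `f` at the points `m z` cofinally at least `f y`.
  have hdown : ∀ x y, ∃ z, m z ≤ m x ∧ m z ≤ m y ∧ f y ≤ f (m z) := fun x y => by
    obtain ⟨z, hxz, hyz⟩ := hlbp.exists_le_le x y
    exact ⟨z, hanti x z hxz, hanti y z hyz, hyz.trans (hm z).1⟩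
  have hne : (Set.range m).Nonempty := ⟨m ⟨a, le_rfl, hab⟩, ⟨_, rfl⟩⟩
  have hglb : IsGLB (Subtype.val '' Set.range m) (sInf (Subtype.val '' Set.range m)) := by
    refine isGLB_csInf (hne.image _) ⟨a, ?_⟩
    rintro _ ⟨x, -, rfl⟩
    exact x.2.1
  have hmem : sInf (Subtype.val '' Set.range m) ∈ Set.Icc a b := by
    obtain ⟨y, hy⟩ := hne
    refine ⟨hglb.2 ?_, (hglb.1 ⟨y, hy, rfl⟩).trans y.2.2⟩
    rintro _ ⟨x, -, rfl⟩
    exact x.2.1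
  refine ⟨⟨_, hmem⟩, fun x => hf.le_apply_of_isGLB hne ?_ hglb ?_⟩
  · rintro _ ⟨y, rfl⟩ _ ⟨y', rfl⟩
    obtain ⟨z, h₁, h₂, -⟩ := hdown y y'
    exact ⟨m z, ⟨z, rfl⟩, h₁, h₂⟩
  · rintro _ ⟨y, rfl⟩
    obtain ⟨z, h₁, -, h₃⟩ := hdown y x
    exact ⟨m z, ⟨z, rfl⟩, h₁, h₃⟩

end VectorLattice

theorem mainTheorem5 {E : Type u} [Ring E] [ConditionallyCompleteLattice E] [Algebra ℝ E]
    [IsPhiAlgebra E] (a b : E) (hab : a ≤ b) (f : Set.Icc a b → E)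
    (hf : OrderContinuous f) (hlbp : LocallyBandPreserving f) :
    ∃ c d : Set.Icc a b, ∀ x : Set.Icc a b, f c ≤ f x ∧ f x ≤ f d := by
  obtain ⟨d, hd⟩ := hlbp.exists_forall_le hf hab
  obtain ⟨c, hc⟩ := hlbp.neg.exists_forall_le hf.neg hab
  exact ⟨c, d, fun x => ⟨neg_le_neg_iff.1 (hc x), hd x⟩⟩
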